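/- A band is a semigroup in which every element is idempotent. For a semigroup $S$ with set of idempotents $E=E(S)$, call $\{e,f\}\subseteq E$ a basic pair if $\{ef,fe\}\cap\{e,f\}\neq\emptyset$; the free idempotent generated semigroup over $S$ is the semigroup given by the presentation $$\mathrm{IG}(S)=\langle E \mid e\cdot f=ef\ \ (\{e,f\}\text{ a basic pair})\rangle .$$ A maximal subgroup of a semigroup is a subsemigroup which is a group and is not properly contained in another such subsemigroup. **Theorem.** Let $G$ be a group. Then there exists a band $B_G$ such that $\mathrm{IG}(B_G)$ has a maximal subgroup isomorphic to $G$. Furthermore, if $G$ is finitely presented, then $B_G$ can be chosen to be finite. The band is explicit. Every group $G$ has a presentation $\langle A\mid R\rangle$ in which every relation has the form $ab=c$ with $a,b,c\in A$, and if $G$ is finitely presented there is such a presentation with $A$ and $R$ finite. Given any such presentation of $G$, let $A_0=A\cup\{0\}$, let $A_0'=\{a' : a\in A_0\}$ be a disjoint copy of $A_0$, and put $I=A_0\cup A_0'$ and $J=A_0\cup\{\infty\}$, where $0,\infty$ are new symbols. Let $T=T_I\times T_J$, where $T_I$ is the semigroup of all maps $I\to I$ written on the left and $T_J$ is the semigroup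 of all maps $J\to J$ written on the right. Let $K\subseteq T$ be the set of all pairs $(\sigma,\tau)$ of constant maps, identified with $I\times J$. For $p,q,t\in A_0$ let $(\sigma,\tau)_{p,q,t}\in T$ be the pair in which $\sigma$ maps $A_0$ to $p$ and $A_0'$ to $q'$, and $\tau$ fixes every element of $A_0$ and maps $\infty$ to $t$. Let $L\subseteq T$ consist of $(\sigma,\tau)_{0,0,0}$, of $(\sigma,\tau)_{0,a,a}$ and $(\sigma,\tau)_{a,a,0}$ for $a\in A$, and of $(\sigma,\tau)_{b,c,a}$ for each relation $ab=c$ in $R$. Then $B_G=K\cup L$ is a subsemigroup of $T$ and a band, $K$ is a rectangular band (that is, $xyx=x$ for all $x,y\in K$), $L$ is a left zero semigroup (that is, $xy=x$ for all $x,y\in L$), $B_G$ is finite if $A$ is finite, and the maximal subgroup of $\mathrm{IG}(B_G)$ containing the generator $(0,0)\in K$ is isomorphic to $G$. -/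

import Mathlib

universe u v

/-! ### Bands and the free idempotent generated semigroup -/

/-- A band is a semigroup in which every element is idempotent. -/
def IsBand (S : Type u) [Semigroup S] : Prop :=
  ∀ x : S, IsIdempotentElem x

/-- `{e, f}` is a basic pair if `{ef, fe}` meets `{e, f}`. -/
def IsBasicPair {S : Type u} [Semigroup S] (e f : S) : Prop :=
  e * f = e ∨ e * f = f ∨ f * e = e ∨ f * e = f

/-- The set `E(S)` of idempotents of `S`, as a type. -/
abbrev Idem (S : Type u) [Semigroup S] : Type u :=
  {e : S // IsIdempotentElem e}

/-- For a basic pair of idempotents the product is again an idempotent. -/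
theorem IsBasicPair.isIdempotentElem_mul {S : Type u} [Semigroup S] {e f : S}
    (he : IsIdempotentElem e) (hf : IsIdempotentElem f) (h : IsBasicPair e f) :
    IsIdempotentElem (e * f) := by
  unfold IsIdempotentElem at *
  rcases h with h | h | h | h
  · rw [h, he]
  · rw [h, hf]
  · rw [mul_assoc, ← mul_assoc f, h, ← mul_assoc, he]
  · rw [mul_assoc, ← mul_assoc f, h, hf]

/-- The defining relations of the free idempotent generated semigroup: the two-letter word `e·f`
is related to the one-letter word `ef`, for every basic pair `{e, f}` of idempotents. -/
inductive IGRel (S : Type u) [Semigroup S] : FreeSemigroup (Idem S) → FreeSemigroup (Idem S) → Prop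
  | basic (e f : Idem S) (h : IsBasicPair (e : S) (f : S)) :
      IGRel S (FreeSemigroup.of e * FreeSemigroup.of f)
        (FreeSemigroup.of ⟨(e : S) * (f : S), h.isIdempotentElem_mul e.2 f.2⟩)

/-- The free idempotent generated semigroup `IG(E(S))` over `S`: the semigroup presented by the
generators `E(S)` and the relations `e·f = ef` for basic pairs `{e, f}`. -/
def IG (S : Type u) [Semigroup S] : Type u :=
  (conGen (IGRel S)).Quotient

instance (S : Type u) [Semigroup S] : Semigroup (IG S) :=
  inferInstanceAs (Semigroup (conGen (IGRel S)).Quotient)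

/-- The generator of `IG(E(S))` given by an idempotent of `S`. -/
def IG.ι {S : Type u} [Semigroup S] (e : Idem S) : IG S :=
  Con.toQuotient (c := conGen (IGRel S)) (FreeSemigroup.of e)

/-! ### Maximal subgroups of a semigroup -/

/-- A subsemigroup is a subgroup if it is a group under the multiplication of the semigroup;
its identity is an idempotent of the ambient semigroup. -/
def IsSubgroupOfSemigroup {S : Type u} [Semigroup S] (H : Subsemigroup S) : Prop :=
  ∃ e ∈ H, ∀ x ∈ H, e * x = x ∧ x * e = x ∧ ∃ y ∈ H, x * y = e ∧ y * x = e

/-- A maximal subgroup: a subgroup not properly contained in another subgroup. -/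
def IsMaximalSubgroup {S : Type u} [Semigroup S] (H : Subsemigroup S) : Prop :=
  Maximal (fun H' : Subsemigroup S => IsSubgroupOfSemigroup H') H

/-! ### Presentations with relations of the form `ab = c` -/

/-- A triple `(a, b, c)` in `R` stands for the relation `ab = c`; these are the relators. -/
def tripleRelators {A : Type u} (R : Set (A × A × A)) : Set (FreeGroup A) :=
  {w | ∃ a b c : A, (a, b, c) ∈ R ∧
    w = FreeGroup.of a * FreeGroup.of b * (FreeGroup.of c)⁻¹}

/-- `G` is presented by the generators `A` and the relations `ab = c`, `(a, b, c) ∈ R`. -/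
def IsPresentedBy (G : Type v) [Group G] (A : Type u) (R : Set (A × A × A)) : Prop :=
  Nonempty (PresentedGroup (tripleRelators R) ≃* G)

namespace BandConstruction

/-! ### The band `K ∪ L` -/

/-- `A₀ = A ∪ {0}`, where `none` is the symbol `0`. -/
abbrev A₀ (A : Type u) : Type u := Option A

/-- `I = A₀ ∪ A₀'`: `Sum.inl a` is `a` and `Sum.inr a` is `a'`. -/
abbrev I (A : Type u) : Type u := A₀ A ⊕ A₀ A

/-- `J = A₀ ∪ {∞}`: `some a` is `a ∈ A₀` and `none` is `∞`. -/
abbrev J (A : Type u) : Type u := Option (A₀ A)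

/-- The direct product of the semigroup of all maps `I → I` written on the left and the semigroup
of all maps `J → J` written on the right (hence the opposite of the usual composition). -/
abbrev T (A : Type u) : Type u := Function.End (I A) × (Function.End (J A))ᵐᵒᵖ

/-- `K`: the pairs `(σ, τ)` of constant maps. -/
def K (A : Type u) : Set (T A) :=
  {x | (∃ i : I A, ∀ k : I A, x.1 k = i) ∧ (∃ j : J A, ∀ l : J A, x.2.unop l = j)}

/-- The pair of constant maps with values `i` and `j`, the element `(i, j)` of `K`. -/
def kElem {A : Type u} (i : I A) (j : J A) : T A :=
  ((fun _ => i : I A → I A), MulOpposite.op (fun _ => j : J A → J A))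

/-- The pair `(σ, τ)` of idempotent maps with `ker σ = {A₀, A₀'}`, `im σ = {p, q'}`,
`im τ = A₀` and `(∞)τ = t`. -/
def lElem {A : Type u} (p q t : A₀ A) : T A :=
  ((Sum.elim (fun _ => Sum.inl p) (fun _ => Sum.inr q) : I A → I A),
    MulOpposite.op (fun j : J A => (some (j.getD t) : J A)))

/-- `L`: the initial pair, two pairs for each generator and one pair for each relation `ab = c`. -/
def L {A : Type u} (R : Set (A × A × A)) : Set (T A) :=
  {lElem none none none} ∪
  {x | ∃ a : A, x = lElem none (some a) (some a)} ∪
  {x | ∃ a : A, x = lElem (some a) (some a) none} ∪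
  {x | ∃ a b c : A, (a, b, c) ∈ R ∧ x = lElem (some b) (some c) (some a)}

theorem exists_lElem_of_mem_L {A : Type u} {R : Set (A × A × A)} {x : T A} (hx : x ∈ L R) :
    ∃ p q t : A₀ A, x = lElem p q t := by
  rcases hx with ((h | ⟨a, h⟩) | ⟨a, h⟩) | ⟨a, b, c, -, h⟩ <;> exact ⟨_, _, _, h⟩

theorem lElem_mul_lElem {A : Type u} (p q t p' q' t' : A₀ A) :
    lElem p q t * lElem p' q' t' = lElem p q t := by
  refine Prod.ext (funext fun i => ?_) (MulOpposite.unop_injective (funext fun j => ?_))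
  · rcases i with i | i <;> rfl
  · rcases j with _ | j <;> rfl

theorem mul_mem_K_left {A : Type u} {x : T A} (hx : x ∈ K A) (y : T A) : x * y ∈ K A := by
  obtain ⟨⟨i, hi⟩, ⟨j, hj⟩⟩ := hx
  exact ⟨⟨i, fun k => hi (y.1 k)⟩, ⟨y.2.unop j, fun l => congrArg y.2.unop (hj l)⟩⟩

theorem mul_mem_K_right {A : Type u} {y : T A} (hy : y ∈ K A) (x : T A) : x * y ∈ K A := by
  obtain ⟨⟨i, hi⟩, ⟨j, hj⟩⟩ := hy
  exact ⟨⟨x.1 i, fun k => congrArg x.1 (hi k)⟩, ⟨j, fun l => hj (x.2.unop l)⟩⟩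

/-- The semigroup `K ∪ L`, a subsemigroup of `T`. -/
def B {A : Type u} (R : Set (A × A × A)) : Subsemigroup (T A) where
  carrier := K A ∪ L R
  mul_mem' := by
    rintro x y (hx | hx) (hy | hy)
    · exact Or.inl (mul_mem_K_left hx y)
    · exact Or.inl (mul_mem_K_left hx y)
    · exact Or.inl (mul_mem_K_right hy x)
    · right
      obtain ⟨p, q, t, rfl⟩ := exists_lElem_of_mem_L hx
      obtain ⟨p', q', t', rfl⟩ := exists_lElem_of_mem_L hy
      rw [lElem_mul_lElem]
      exact hx

/-- The element `(0, 0)` of `K`, as an element of `K ∪ L`. -/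
def e₀ {A : Type u} (R : Set (A × A × A)) : B R :=
  ⟨kElem (Sum.inl none) (some none), Or.inl ⟨⟨_, fun _ => rfl⟩, ⟨_, fun _ => rfl⟩⟩⟩

theorem isIdempotentElem_e₀ {A : Type u} (R : Set (A × A × A)) : IsIdempotentElem (e₀ R) :=
  rfl

end BandConstruction

/-! The maximal subgroup at `ε₀` is the group of units of its corner. In it the products
`(0,j)(i,0)` are units p(j,i), equal to 1 in row 0 and in column 0. An element of `L` with
parameters p, q, t can be inserted between two factors whenever it forms a basic pair with each, and
this relates the p(j,i). The element with p = q = t = 0 makes each row in A₀ trivial on A₀ and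
constant on A₀'. Those with parameters (a,a,0) and (0,a,a) identify the remaining entries, leaving
one unit a⁻¹ = p(∞,a) per generator. The element for ab = c then says c⁻¹ = b⁻¹a⁻¹
(`sandwichUnit_of_mem_L`, `gen_mul_gen`). Thus the presented group maps to the maximal subgroup.

The map is onto because any product of generators, applied to some `(i,0)`, can be rewritten letter
by letter as `(k,0)` times an element of the image (`exists_mul_ε_eq`). It is injective because `IG`
acts on I × G as on a column of a Rees matrix semigroup with sandwich matrix p: `(i,j)` sends (k,g)
to (i, p(j,i)⁻¹p(j,k)g), while `L` moves only the first coordinate (`act_mul`). On the fibre over 0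
the image of g acts as left multiplication by g (`actIG_toH₀`). -/

/-! ### Maximal subgroups -/

section MaximalSubgroup

variable {S : Type u} [Semigroup S]

/-- The group of units of the monoid `eSe`, for an idempotent `e`. -/
def cornerUnits (e : S) (_he : IsIdempotentElem e) : Subsemigroup S where
  carrier := {x | e * x = x ∧ x * e = x ∧ ∃ y, e * y = y ∧ y * e = y ∧ x * y = e ∧ y * x = e}
  mul_mem' := by
    rintro a b ⟨ha, ha', c, hc, hc', hac, hca⟩ ⟨hb, hb', d, hd, hd', hbd, hdb⟩
    refine ⟨by rw [← mul_assoc, ha], by rw [mul_assoc, hb'], d * c, by rw [← mul_assoc, hd],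
      by rw [mul_assoc, hc'], ?_, ?_⟩
    · rw [mul_assoc, ← mul_assoc b, hbd, hc, hac]
    · rw [mul_assoc, ← mul_assoc c, hca, hb, hdb]

theorem mem_cornerUnits_self (e : S) (he : IsIdempotentElem e) : e ∈ cornerUnits e he :=
  ⟨he, he, e, he, he, he, he⟩

theorem exists_inv_mem_cornerUnits {e : S} {he : IsIdempotentElem e} {x : S}
    (hx : x ∈ cornerUnits e he) : ∃ y ∈ cornerUnits e he, x * y = e ∧ y * x = e := by
  obtain ⟨h1, h2, y, h3, h4, h5, h6⟩ := hx
  exact ⟨y, ⟨h3, h4, x, h1, h2, h6, h5⟩, h5, h6⟩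

noncomputable instance (e : S) (he : IsIdempotentElem e) : Group (cornerUnits e he) :=
  letI : One (cornerUnits e he) := ⟨⟨e, mem_cornerUnits_self e he⟩⟩
  letI : Inv (cornerUnits e he) :=
    ⟨fun x => ⟨(exists_inv_mem_cornerUnits x.2).choose,
      (exists_inv_mem_cornerUnits x.2).choose_spec.1⟩⟩
  Group.ofLeftAxioms mul_assoc (fun x => Subtype.ext x.2.1)
    (fun x => Subtype.ext (exists_inv_mem_cornerUnits x.2).choose_spec.2.2)

theorem coe_one_cornerUnits (e : S) (he : IsIdempotentElem e) :
    ((1 : cornerUnits e he) : S) = e :=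
  rfl

/-- A group has only one idempotent, so a larger subgroup also has identity `e`, and its elements
are then units of the corner. -/
theorem isMaximalSubgroup_cornerUnits (e : S) (he : IsIdempotentElem e) :
    IsMaximalSubgroup (cornerUnits e he) := by
  refine ⟨⟨e, mem_cornerUnits_self e he, fun x hx =>
    ⟨hx.1, hx.2.1, exists_inv_mem_cornerUnits hx⟩⟩, ?_⟩
  rintro H ⟨f, hf, hH⟩ hle x hx
  have hef : e = f := by
    obtain ⟨h1, -, y, -, h3, -⟩ := hH e (hle (mem_cornerUnits_self e he))
    calc e = e * (e * y) := by rw [h3, (hH e (hle (mem_cornerUnits_self e he))).2.1]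
      _ = f := by rw [← mul_assoc, he.eq, h3]
  subst hef
  obtain ⟨h1, h2, y, hy, h3, h4⟩ := hH x hx
  exact ⟨h1, h2, y, (hH y hy).1, (hH y hy).2.1, h3, h4⟩

end MaximalSubgroup

/-! ### The universal property of `IG` -/

namespace IG

variable {S : Type u} [Semigroup S]

theorem ι_mul_ι (e f g : Idem S) (h : IsBasicPair (e : S) (f : S)) (hg : (e : S) * f = g) :
    ι e * ι f = ι g := by
  obtain rfl : g = ⟨(e : S) * f, h.isIdempotentElem_mul e.2 f.2⟩ := Subtype.ext hg.symm
  exact (Con.eq _).2 (ConGen.Rel.of _ _ (IGRel.basic e f h))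

theorem induction_on {P : IG S → Prop} (x : IG S) (of : ∀ e, P (ι e))
    (mul : ∀ e y, P (ι e) → P y → P (ι e * y)) : P x := by
  induction x using Con.induction_on with
  | H w =>
    induction w using FreeSemigroup.recOnMul with
    | ih1 e => exact of e
    | ih2 e w h1 h2 => exact mul e _ h1 h2

/-- A map on idempotents respecting products of basic pairs extends to `IG`. -/
def lift {M : Type v} [Semigroup M] (f : Idem S → M)
    (hf : ∀ e e' : Idem S, ∀ h : IsBasicPair (e : S) (e' : S),
      f e * f e' = f ⟨(e : S) * e', h.isIdempotentElem_mul e.2 e'.2⟩) : IG S →ₙ* M where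
  toFun x := Con.liftOn x (FreeSemigroup.lift f) (by
    intro a b hab
    have : conGen (IGRel S) ≤ Con.ker (FreeSemigroup.lift f) := by
      refine Con.conGen_le.2 ?_
      rintro _ _ ⟨e, e', h⟩
      simpa [Con.ker_rel] using hf e e' h
    exact this hab)
  map_mul' x y := by
    induction x using Con.induction_on with
    | H x =>
      induction y using Con.induction_on with
      | H y => exact map_mul (FreeSemigroup.lift f) x y

end IG

/-! ### The maximal subgroup for the explicit band -/

namespace BandConstruction

variable {A : Type u} {R : Set (A × A × A)}

theorem kElem_mem_K (i : I A) (j : J A) : kElem i j ∈ K A :=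
  ⟨⟨i, fun _ => rfl⟩, ⟨j, fun _ => rfl⟩⟩

theorem exists_kElem_of_mem_K {x : T A} (hx : x ∈ K A) : ∃ i j, x = kElem i j := by
  obtain ⟨⟨i, hi⟩, ⟨j, hj⟩⟩ := hx
  exact ⟨i, j, Prod.ext (funext hi) (MulOpposite.unop_injective (funext hj))⟩

theorem kElem_mul_kElem (i k : I A) (j l : J A) : kElem i j * kElem k l = kElem i l :=
  rfl

/-- The element `(i, j)` of `K`, as an idempotent of `K ∪ L`. -/
def kIdem (R : Set (A × A × A)) (i : I A) (j : J A) : Idem (B R) :=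
  ⟨⟨kElem i j, Or.inl (kElem_mem_K i j)⟩, rfl⟩

/-- An element of `L`, as an idempotent of `K ∪ L`. -/
def lIdem {p q t : A₀ A} (h : lElem p q t ∈ L R) : Idem (B R) :=
  ⟨⟨lElem p q t, Or.inr h⟩, Subtype.ext (lElem_mul_lElem ..)⟩

@[elab_as_elim]
theorem idem_cases {P : Idem (B R) → Prop} (e : Idem (B R)) (hK : ∀ i j, P (kIdem R i j))
    (hL : ∀ p q t, ∀ h : lElem p q t ∈ L R, P (lIdem h)) : P e := by
  obtain ⟨⟨x, hx | hx⟩, he⟩ := e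
  · obtain ⟨i, j, rfl⟩ := exists_kElem_of_mem_K hx
    exact hK i j
  · obtain ⟨p, q, t, rfl⟩ := exists_lElem_of_mem_L hx
    exact hL p q t hx

theorem end_mul_apply {α : Type*} (f g : Function.End α) (x : α) : (f * g) x = f (g x) :=
  rfl

theorem kElem_inj {i k : I A} {j l : J A} : kElem i j = kElem k l ↔ i = k ∧ j = l := by
  refine ⟨fun h => ⟨congrFun (congrArg Prod.fst h) (Sum.inl none),
    congrFun (congrArg (fun x : T A => x.2.unop) h) none⟩, ?_⟩
  rintro ⟨rfl, rfl⟩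
  rfl

theorem kElem_ne_lElem (i : I A) (j : J A) (p q t : A₀ A) : kElem i j ≠ lElem p q t := by
  intro h
  have h1 : i = Sum.inl p := congrFun (congrArg Prod.fst h) (Sum.inl none)
  have h2 : i = Sum.inr q := congrFun (congrArg Prod.fst h) (Sum.inr none)
  exact Sum.inl_ne_inr (h1.symm.trans h2)

/-! #### The action of `IG` on `I × G` -/

section Action

variable {G : Type v} [Group G] (f : A → G)

/-- The extension of `f` to `A₀` with `0 ↦ 1`. -/
def extendOne : A₀ A → G
  | none => 1
  | some a => f a

/-- The sandwich matrix. -/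
def sandwich : J A → I A → G
  | none, Sum.inl a => (extendOne f a)⁻¹
  | none, Sum.inr a => (extendOne f a)⁻¹
  | some _, Sum.inl _ => 1
  | some j, Sum.inr _ => (extendOne f j)⁻¹

theorem sandwich_zero_left (i : I A) : sandwich f (some none) i = 1 := by
  rcases i with i | i <;> simp [sandwich, extendOne]

theorem sandwich_zero_right (j : J A) : sandwich f j (Sum.inl none) = 1 := by
  rcases j with _ | j <;> simp [sandwich, extendOne]

/-- Only the elements coming from `R` impose a condition; for the others a factor is 1. -/
theorem extendOne_mul_of_mem_L {f : A → G} (hf : ∀ a b c, (a, b, c) ∈ R → f a * f b = f c)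
    {p q t : A₀ A} (h : lElem p q t ∈ L R) :
    extendOne f t * extendOne f p = extendOne f q := by
  -- Evaluating σ at 0 and 0', and τ at ∞, recovers the three parameters.
  have key {p' q' t' : A₀ A} (h : lElem p q t = lElem p' q' t') : p = p' ∧ q = q' ∧ t = t' :=
    ⟨Sum.inl_injective (congrFun (congrArg Prod.fst h) (Sum.inl none)),
      Sum.inr_injective (congrFun (congrArg Prod.fst h) (Sum.inr none)),
      Option.some_injective _ (congrFun (congrArg (fun x : T A => x.2.unop) h) none)⟩
  rcases h with ((h | ⟨a, h⟩) | ⟨a, h⟩) | ⟨a, b, c, hR, h⟩ <;>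
    obtain ⟨rfl, rfl, rfl⟩ := key h
  · simp [extendOne]
  · simp [extendOne]
  · simp [extendOne]
  · exact hf _ _ _ hR

/-- The action of an element of the band on `I × G`. -/
def act (x : T A) : Function.End (I A × G) := fun y =>
  (x.1 y.1, (sandwich f (x.2.unop (some none)) (x.1 y.1))⁻¹ *
    sandwich f (x.2.unop (some none)) y.1 * y.2)

theorem act_kElem (i k : I A) (j : J A) (g : G) :
    act f (kElem i j) (k, g) = (i, (sandwich f j i)⁻¹ * sandwich f j k * g) :=
  rfl

/-- Since τ fixes 0, the formula for `act` uses row 0 of the matrix, which is trivial. -/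
theorem act_lElem (p q t : A₀ A) (k : I A) (g : G) :
    act f (lElem p q t) (k, g) = ((lElem p q t).1 k, g) := by
  have : (lElem p q t).2.unop (some none) = some none := rfl
  simp [act, this, sandwich_zero_left]

theorem kElem_mul_lElem (i : I A) (j : J A) (p q t : A₀ A) :
    kElem i j * lElem p q t = kElem i (some (j.getD t)) :=
  rfl

theorem lElem_mul_kElem (i : I A) (j : J A) (p q t : A₀ A) :
    lElem p q t * kElem i j = kElem ((lElem p q t).1 i) j :=
  rfl

theorem lElem_fst_inl (p q t i : A₀ A) : (lElem p q t).1 (Sum.inl i) = Sum.inl p := rfl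

theorem lElem_fst_inr (p q t i : A₀ A) : (lElem p q t).1 (Sum.inr i) = Sum.inr q := rfl

/-- A row indexed by A₀ depends only on which half of I the column lies in, and σ preserves the
halves. -/
theorem sandwich_some_lElem_fst (j : A₀ A) (p q t : A₀ A) (i : I A) :
    sandwich f (some j) ((lElem p q t).1 i) = sandwich f (some j) i := by
  rcases i with i | i <;> rfl

/-- The one compatibility condition that needs the relations of `R`. It allows rows ∞ and t to be
exchanged across an element of `L`. -/
theorem sandwich_none_lElem_fst (hf : ∀ a b c, (a, b, c) ∈ R → f a * f b = f c) {p q t : A₀ A}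
    (hl : lElem p q t ∈ L R) {i : I A} (hi : (lElem p q t).1 i = i) (k : I A) :
    (sandwich f none i)⁻¹ * sandwich f none ((lElem p q t).1 k) =
      (sandwich f (some t) i)⁻¹ * sandwich f (some t) k := by
  have h := extendOne_mul_of_mem_L hf hl
  rcases i with i | i
  · obtain rfl : p = i := Sum.inl_injective hi
    rcases k with k | k <;> simp [lElem_fst_inl, lElem_fst_inr, sandwich, ← h]
  · obtain rfl : q = i := Sum.inr_injective hi
    rcases k with k | k <;> simp [lElem_fst_inl, lElem_fst_inr, sandwich, ← h]

theorem act_mul (hf : ∀ a b c, (a, b, c) ∈ R → f a * f b = f c) (e e' : Idem (B R))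
    (h : IsBasicPair (e : B R) (e' : B R)) :
    act f e.1.1 * act f e'.1.1 = act f (e.1.1 * e'.1.1) := by
  have h' : IsBasicPair e.1.1 e'.1.1 := by
    simpa only [IsBasicPair, Subtype.ext_iff, MulMemClass.coe_mul] using h
  clear h
  revert h'
  refine idem_cases e (fun i j => ?_) (fun p q t hl => ?_) <;>
  refine idem_cases e' (fun i' j' => ?_) (fun p' q' t' hl' => ?_) <;>
  intro h <;> funext ⟨k, g⟩ <;>
  simp only [kIdem, lIdem, IsBasicPair, kElem_mul_kElem, kElem_mul_lElem, lElem_mul_kElem,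
    lElem_mul_lElem, kElem_inj, kElem_ne_lElem, and_true,
    true_and, or_false, false_or, end_mul_apply, act_kElem,
    act_lElem, Prod.mk.injEq] at h ⊢
  · have : i = i' ∨ j = j' := by tauto
    rcases this with rfl | rfl <;> group
  · rcases j with _ | j
    · have h : (lElem p' q' t').1 i = i := by simpa using h
      simpa using sandwich_none_lElem_fst f hf hl' h k
    · simp [sandwich_some_lElem_fst]
  · rcases h with h | h
    · rw [h]
    · rw [← h, sandwich_some_lElem_fst]
  · exact congrFun (congrArg Prod.fst (lElem_mul_lElem p q t p' q' t')) k

/-- The action of `IG` on `I × G`. -/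
def actIG (hf : ∀ a b c, (a, b, c) ∈ R → f a * f b = f c) :
    IG (B R) →ₙ* Function.End (I A × G) :=
  IG.lift (fun e => act f e.1.1) (act_mul f hf)

end Action

/-! #### Products of generators in `IG` -/

/-- The generator of `IG` given by `(i, j)`. -/
def ε (R : Set (A × A × A)) (i : I A) (j : J A) : IG (B R) :=
  IG.ι (kIdem R i j)

@[simp]
theorem ε_mul_row (i : I A) (j l : J A) : ε R i j * ε R i l = ε R i l :=
  IG.ι_mul_ι _ _ _ (Or.inr (Or.inl rfl)) rfl

@[simp]
theorem ε_mul_col (i k : I A) (j : J A) : ε R i j * ε R k j = ε R i j :=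
  IG.ι_mul_ι _ _ _ (Or.inl rfl) rfl

@[simp]
theorem ε_mul_row_assoc (i : I A) (j l : J A) (x : IG (B R)) :
    ε R i j * (ε R i l * x) = ε R i l * x := by
  rw [← mul_assoc, ε_mul_row]

@[simp]
theorem ε_mul_col_assoc (i k : I A) (j : J A) (x : IG (B R)) :
    ε R i j * (ε R k j * x) = ε R i j * x := by
  rw [← mul_assoc, ε_mul_col]

theorem ε_some_mul_lIdem (i : I A) (j : A₀ A) {p q t : A₀ A} (h : lElem p q t ∈ L R) :
    ε R i (some j) * IG.ι (lIdem h) = ε R i (some j) :=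
  IG.ι_mul_ι _ _ _ (Or.inl rfl) rfl

theorem lIdem_mul_ε_some (i : I A) (j : A₀ A) {p q t : A₀ A} (h : lElem p q t ∈ L R) :
    IG.ι (lIdem h) * ε R i (some j) = ε R ((lElem p q t).1 i) (some j) :=
  IG.ι_mul_ι _ _ _ (Or.inr (Or.inr (Or.inr rfl))) rfl

/-- The product is neither factor. The pair is basic because σ fixes p, so the product in the
opposite order is `(p,∞)`. -/
theorem ε_none_mul_lIdem {p q t : A₀ A} (h : lElem p q t ∈ L R) :
    ε R (Sum.inl p) none * IG.ι (lIdem h) = ε R (Sum.inl p) (some t) :=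
  IG.ι_mul_ι _ _ _ (Or.inr (Or.inr (Or.inl rfl))) rfl

/-- The idempotent `(0, 0)` of `IG`. -/
abbrev ε₀ (R : Set (A × A × A)) : IG (B R) :=
  ε R (Sum.inl none) (some none)

theorem isIdempotentElem_ε₀ : IsIdempotentElem (ε₀ R) :=
  ε_mul_row ..

/-- The maximal subgroup containing `(0, 0)`. -/
abbrev H₀ (R : Set (A × A × A)) : Subsemigroup (IG (B R)) :=
  cornerUnits (ε₀ R) isIdempotentElem_ε₀

/-! ### Sandwich matrix entries as units of the corner -/

theorem sandwichUnit_mul (i : I A) (j : J A) :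
    ε R (Sum.inl none) j * ε R i (some none) * (ε₀ R * ε R i j * ε₀ R) = ε₀ R := by
  simp [mul_assoc]

theorem mul_sandwichUnit (i : I A) (j : J A) :
    (ε₀ R * ε R i j * ε₀ R) * (ε R (Sum.inl none) j * ε R i (some none)) = ε₀ R := by
  simp [mul_assoc]

/-- The product `(0, j) (i, 0)` as an element of the maximal subgroup. -/
def sandwichUnit (R : Set (A × A × A)) (j : J A) (i : I A) : H₀ R :=
  ⟨ε R (Sum.inl none) j * ε R i (some none), by
    refine ⟨?_, ?_, ε₀ R * ε R i j * ε₀ R, ?_, ?_, sandwichUnit_mul i j, mul_sandwichUnit i j⟩ <;>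
      simp [mul_assoc]⟩

theorem coe_sandwichUnit (j : J A) (i : I A) :
    (sandwichUnit R j i : IG (B R)) = ε R (Sum.inl none) j * ε R i (some none) :=
  rfl

theorem coe_inv_sandwichUnit (j : J A) (i : I A) :
    (((sandwichUnit R j i)⁻¹ : H₀ R) : IG (B R)) = ε₀ R * ε R i j * ε₀ R := by
  have h : sandwichUnit R j i * ⟨ε₀ R * ε R i j * ε₀ R, by
      refine ⟨?_, ?_, ε R (Sum.inl none) j * ε R i (some none), ?_, ?_, mul_sandwichUnit i j,
        sandwichUnit_mul i j⟩ <;>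
      simp [mul_assoc]⟩ = 1 :=
    Subtype.ext (sandwichUnit_mul i j)
  rw [inv_eq_of_mul_eq_one_right h]

theorem sandwichUnit_zero_left (i : I A) : sandwichUnit R (some none) i = 1 :=
  Subtype.ext (ε_mul_col ..)

theorem sandwichUnit_zero_right (j : J A) : sandwichUnit R j (Sum.inl none) = 1 :=
  Subtype.ext (ε_mul_row ..)

/-- The element of `L` can be inserted between `(0,j)` and `(i,0)`: the left factor absorbs it, the
right one is moved by σ. -/
theorem sandwichUnit_some (j : A₀ A) (i : I A) {p q t : A₀ A} (h : lElem p q t ∈ L R) :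
    sandwichUnit R (some j) ((lElem p q t).1 i) = sandwichUnit R (some j) i := by
  refine Subtype.ext ?_
  rw [coe_sandwichUnit, coe_sandwichUnit, ← lIdem_mul_ε_some _ _ h, ← mul_assoc,
    ε_some_mul_lIdem]

theorem lElem_zero_mem_L : (lElem none none none : T A) ∈ L R :=
  Or.inl (Or.inl (Or.inl rfl))

theorem sandwichUnit_some_inl (j i : A₀ A) : sandwichUnit R (some j) (Sum.inl i) = 1 :=
  (sandwichUnit_some j _ (lElem_zero_mem_L (R := R))).symm.trans (sandwichUnit_zero_right _)

theorem sandwichUnit_some_inr (j i : A₀ A) :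
    sandwichUnit R (some j) (Sum.inr i) = sandwichUnit R (some j) (Sum.inr none) :=
  (sandwichUnit_some j _ (lElem_zero_mem_L (R := R))).symm

/-- Inserting the element l of `L` gives `(p,∞)(q',0) = (p,∞)·l·(0',0) = (p,t)(0',0)`; the entry in
row t, column p is trivial. -/
theorem sandwichUnit_of_mem_L {p q t : A₀ A} (h : lElem p q t ∈ L R) :
    sandwichUnit R none (Sum.inr q) =
      sandwichUnit R none (Sum.inl p) * sandwichUnit R (some t) (Sum.inr none) := by
  have key (j : J A) (k : I A) : (((sandwichUnit R j (Sum.inl p))⁻¹ * sandwichUnit R j k : H₀ R) :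
      IG (B R)) = ε₀ R * (ε R (Sum.inl p) j * ε R k (some none)) := by
    rw [MulMemClass.coe_mul, coe_inv_sandwichUnit, coe_sandwichUnit]
    simp [mul_assoc]
  rw [← inv_mul_eq_iff_eq_mul]
  suffices (sandwichUnit R none (Sum.inl p))⁻¹ * sandwichUnit R none (Sum.inr q) =
      (sandwichUnit R (some t) (Sum.inl p))⁻¹ * sandwichUnit R (some t) (Sum.inr none) by
    rw [this, sandwichUnit_some_inl, inv_one, one_mul]
  refine Subtype.ext ?_
  rw [key, key, ← ε_none_mul_lIdem h, mul_assoc (ε R _ _), lIdem_mul_ε_some]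
  rfl

variable (R) in
/-- The generator of the maximal subgroup corresponding to `a`. -/
noncomputable def gen (a : A) : H₀ R :=
  (sandwichUnit R none (Sum.inl (some a)))⁻¹

theorem sandwichUnit_none_inl (a : A₀ A) :
    sandwichUnit R none (Sum.inl a) = (extendOne (gen R) a)⁻¹ := by
  rcases a with _ | a
  · simp [extendOne, sandwichUnit_zero_right]
  · simp [extendOne, gen]

/-- Uses the element of `L` with parameters (a,a,0). -/
theorem sandwichUnit_none_inr (a : A₀ A) :
    sandwichUnit R none (Sum.inr a) = (extendOne (gen R) a)⁻¹ := by
  rw [← sandwichUnit_none_inl]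
  have h : lElem a a none ∈ L R := by
    rcases a with _ | a
    · exact lElem_zero_mem_L
    · exact Or.inl (Or.inr ⟨a, rfl⟩)
  rw [sandwichUnit_of_mem_L h, sandwichUnit_zero_left, mul_one]

/-- Uses the element of `L` with parameters (0,a,a). -/
theorem sandwichUnit_some_inr_zero (a : A₀ A) :
    sandwichUnit R (some a) (Sum.inr none) = (extendOne (gen R) a)⁻¹ := by
  rw [← sandwichUnit_none_inr]
  have h : lElem none a a ∈ L R := by
    rcases a with _ | a
    · exact lElem_zero_mem_L
    · exact Or.inl (Or.inl (Or.inr ⟨a, rfl⟩))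
  rw [sandwichUnit_of_mem_L h, sandwichUnit_zero_right, one_mul]

theorem sandwichUnit_eq_sandwich (j : J A) (i : I A) :
    sandwichUnit R j i = sandwich (gen R) j i := by
  rcases j with _ | j <;> rcases i with i | i
  · exact sandwichUnit_none_inl i
  · exact sandwichUnit_none_inr i
  · exact sandwichUnit_some_inl j i
  · rw [sandwichUnit_some_inr, sandwichUnit_some_inr_zero, sandwich]

theorem gen_mul_gen {a b c : A} (h : (a, b, c) ∈ R) : gen R a * gen R b = gen R c := by
  have := sandwichUnit_of_mem_L (R := R) (p := some b) (q := some c) (t := some a)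
    (Or.inr ⟨a, b, c, h, rfl⟩)
  rw [sandwichUnit_none_inr, sandwichUnit_none_inl, sandwichUnit_some_inr_zero, ← mul_inv_rev,
    inv_inj] at this
  exact this.symm

/-! ### Isomorphism of the presented group with the maximal subgroup -/

variable (R) in
/-- The homomorphism from the presented group to the maximal subgroup. -/
noncomputable def toH₀ : PresentedGroup (tripleRelators R) →* H₀ R :=
  PresentedGroup.toGroup (f := gen R) (by
    rintro _ ⟨a, b, c, h, rfl⟩
    simp [gen_mul_gen h])

theorem toH₀_of (a : A) : toH₀ R (PresentedGroup.of a) = gen R a :=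
  PresentedGroup.toGroup.of _

theorem of_mul_of_eq_of {a b c : A} (h : (a, b, c) ∈ R) :
    (PresentedGroup.of a * PresentedGroup.of b : PresentedGroup (tripleRelators R)) =
      PresentedGroup.of c :=
  PresentedGroup.mk_eq_mk_of_mul_inv_mem ⟨a, b, c, h, rfl⟩

theorem extendOne_map {G : Type*} {G' : Type*} [Group G] [Group G'] (φ : G →* G') (f : A → G)
    (a : A₀ A) : extendOne (fun a => φ (f a)) a = φ (extendOne f a) := by
  rcases a with _ | a <;> simp [extendOne]

theorem sandwich_map {G : Type*} {G' : Type*} [Group G] [Group G'] (φ : G →* G') (f : A → G)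
    (j : J A) (i : I A) : sandwich (fun a => φ (f a)) j i = φ (sandwich f j i) := by
  rcases j with _ | j <;> rcases i with i | i <;> simp [sandwich, extendOne_map]

theorem sandwichUnit_mem_range (j : J A) (i : I A) : sandwichUnit R j i ∈ (toH₀ R).range := by
  refine ⟨sandwich PresentedGroup.of j i, ?_⟩
  rw [← sandwich_map, sandwichUnit_eq_sandwich]
  simp only [toH₀_of]

/-- For a letter of `K`, `(k,l)(i,0)` equals `(k,0)p(l,k)⁻¹p(l,i)`; a letter of `L` only moves the
first index. Induction on words combines these. -/
theorem exists_mul_ε_eq (x : IG (B R)) (i : I A) :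
    ∃ k, ∃ h ∈ (toH₀ R).range, x * ε R i (some none) = ε R k (some none) * (h : IG (B R)) := by
  induction x using IG.induction_on generalizing i with
  | of e =>
    refine idem_cases e (fun k l => ?_) (fun p q t hl => ?_)
    · refine ⟨k, (sandwichUnit R l k)⁻¹ * sandwichUnit R l i,
        mul_mem (inv_mem (sandwichUnit_mem_range l k)) (sandwichUnit_mem_range l i), ?_⟩
      rw [MulMemClass.coe_mul, coe_inv_sandwichUnit, coe_sandwichUnit]
      simp [mul_assoc]
      rfl
    · refine ⟨(lElem p q t).1 i, 1, one_mem _, (lIdem_mul_ε_some i none hl).trans ?_⟩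
      rw [coe_one_cornerUnits, ε_mul_col]
  | mul e y he hy =>
    obtain ⟨k, h, hh, hk⟩ := hy i
    obtain ⟨k', h', hh', hk'⟩ := he k
    exact ⟨k', h' * h, mul_mem hh' hh, by
      rw [mul_assoc, hk, ← mul_assoc, hk', MulMemClass.coe_mul, mul_assoc]⟩

theorem toH₀_surjective : Function.Surjective (toH₀ R) := by
  intro x
  obtain ⟨k, h, hh, hk⟩ := exists_mul_ε_eq (x : IG (B R)) (Sum.inl none)
  suffices x = h by rwa [this]
  refine Subtype.ext ?_
  -- With i = 0, x = ε₀xε₀ = ε₀·`(k,0)`·h = ε₀h = h.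
  rw [← x.2.2.1, ← x.2.1, mul_assoc, hk, ← mul_assoc, ε_mul_col, h.2.1]

theorem actIG_toH₀ (g : PresentedGroup (tripleRelators R)) (x : PresentedGroup (tripleRelators R)) :
    actIG PresentedGroup.of (fun _ _ _ => of_mul_of_eq_of) (toH₀ R g : IG (B R))
      (Sum.inl none, x) = (Sum.inl none, g * x) := by
  set ρ := actIG (R := R) (PresentedGroup.of (rels := tripleRelators R))
    (fun _ _ _ => of_mul_of_eq_of)
  have hone (x) : ρ (ε₀ R) (Sum.inl none, x) = (Sum.inl none, x) := by
    refine (act_kElem ..).trans ?_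
    simp [sandwich_zero_right]
  let N : Subgroup (PresentedGroup (tripleRelators R)) :=
    { carrier := {g | ∀ x, ρ (toH₀ R g : IG (B R)) (Sum.inl none, x) = (Sum.inl none, g * x)}
      one_mem' := fun x => by rw [map_one, coe_one_cornerUnits, hone, one_mul]
      mul_mem' := fun {a b} ha hb x => by
        rw [map_mul, MulMemClass.coe_mul, map_mul, end_mul_apply, hb, ha, mul_assoc]
      inv_mem' := fun {a} ha x => by
        -- `ε₀` is the identity only on the fibre over 0, so the inverse is handled by writing a
        -- point of the fibre as the image of another under a.
        obtain ⟨y, rfl⟩ : ∃ y, a * y = x := ⟨a⁻¹ * x, by simp⟩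
        rw [← ha, ← end_mul_apply (ρ _), ← map_mul, ← MulMemClass.coe_mul, ← map_mul,
          inv_mul_cancel, map_one, coe_one_cornerUnits, hone,
          inv_mul_cancel_left] }
  have hN (a : A) : PresentedGroup.of a ∈ N := by
    -- The inverse of the generator is the explicit product `(0,∞)(a,0)`.
    rw [← inv_mem_iff]
    intro x
    rw [map_inv, toH₀_of, gen, inv_inv, coe_sandwichUnit, map_mul, end_mul_apply]
    refine (congrArg _ (act_kElem ..)).trans ((act_kElem ..).trans ?_)
    simp [sandwich, extendOne]
  exact PresentedGroup.generated_by _ N hN g x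

theorem toH₀_injective : Function.Injective (toH₀ R) := by
  intro g h hgh
  have := actIG_toH₀ (R := R) g 1
  rw [hgh, actIG_toH₀] at this
  simpa using this.symm

theorem isBand_B (R : Set (A × A × A)) : IsBand (B R) := by
  rintro ⟨x, hx | hx⟩
  · obtain ⟨i, j, rfl⟩ := exists_kElem_of_mem_K hx
    exact (kIdem R i j).2
  · obtain ⟨p, q, t, rfl⟩ := exists_lElem_of_mem_L hx
    exact (lIdem hx).2

theorem finite_B [Finite A] (R : Set (A × A × A)) : Finite (B R) := by
  have : Finite (Function.End (I A)) := inferInstanceAs (Finite (I A → I A))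
  have : Finite (Function.End (J A)) := inferInstanceAs (Finite (J A → J A))
  have : Finite (Function.End (J A))ᵐᵒᵖ := Finite.of_equiv _ MulOpposite.opEquiv
  infer_instance

theorem exists_maximalSubgroup {G : Type v} [Group G] (h : IsPresentedBy G A R) :
    ∃ H : Subsemigroup (IG (B R)), IsMaximalSubgroup H ∧
      IG.ι ⟨e₀ R, isIdempotentElem_e₀ R⟩ ∈ H ∧ Nonempty (H ≃* G) := by
  obtain ⟨φ⟩ := h
  exact ⟨H₀ R, isMaximalSubgroup_cornerUnits _ _, mem_cornerUnits_self _ isIdempotentElem_ε₀,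
    ⟨(MulEquiv.ofBijective (toH₀ R) ⟨toH₀_injective, toH₀_surjective⟩).symm.trans φ⟩⟩

end BandConstruction

/-! ### Presentations with relations of the form `ab = c` -/

section Presentations

/-- All relations `ab = c` between elements of a subset of a group. -/
def trueTriples {G : Type u} [Group G] (X : Set G) : Set (X × X × X) :=
  {r | (r.1 : G) * r.2.1 = r.2.2}

theorem of_mul_of_eq_of_trueTriples {G : Type u} [Group G] {X : Set G} {a b c : X}
    (h : (a : G) * b = c) :
    (PresentedGroup.of a * PresentedGroup.of b :
      PresentedGroup (tripleRelators (trueTriples X))) = PresentedGroup.of c :=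
  BandConstruction.of_mul_of_eq_of h

/-- The evaluation map from the group presented by the true relations. -/
def evalTriples {G : Type u} [Group G] (X : Set G) :
    PresentedGroup (tripleRelators (trueTriples X)) →* G :=
  PresentedGroup.toGroup (f := Subtype.val) (by
    rintro _ ⟨a, b, c, h, rfl⟩
    have h : (a : G) * b = c := h
    simp [h])

theorem evalTriples_of {G : Type u} [Group G] {X : Set G} (a : X) :
    evalTriples X (PresentedGroup.of a) = a :=
  PresentedGroup.toGroup.of _

/-- The presentation is the full multiplication table of `G`. -/
theorem isPresentedBy_univ (G : Type u) [Group G] :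
    IsPresentedBy G (Set.univ : Set G) (trueTriples Set.univ) := by
  let φ : G →* PresentedGroup (tripleRelators (trueTriples (Set.univ : Set G))) :=
    MonoidHom.mk' (fun g => PresentedGroup.of ⟨g, trivial⟩)
      fun a b => (of_mul_of_eq_of_trueTriples rfl).symm
  refine ⟨MonoidHom.toMulEquiv (evalTriples _) φ ?_ ?_⟩
  · refine PresentedGroup.ext fun a => ?_
    simp [evalTriples_of, φ]
  · ext g
    simp [evalTriples_of, φ]

/-- Takes as generators the values of all words up to a bounded length, and as relations every true
product among them. Reading a relator letter by letter stays inside this set, so these relations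
already force it to be trivial. -/
theorem exists_finite_isPresentedBy (G : Type u) [Group G] (hG : Group.IsFinitelyPresented G) :
    ∃ (A : Type u) (R : Set (A × A × A)), Finite A ∧ R.Finite ∧ IsPresentedBy G A R := by
  obtain ⟨n, s, hs, ⟨θ⟩⟩ := hG.exists_mulEquiv_presentedGroup
  let π : FreeGroup (Fin n) →* G := θ.symm.toMonoidHom.comp (PresentedGroup.mk s)
  have hπ : ∀ r ∈ s, π r = 1 := fun r hr => by
    simp [π, PresentedGroup.one_of_mem hr]
  obtain ⟨N, hN⟩ : ∃ N, ∀ r ∈ s, r.toWord.length ≤ N := by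
    obtain ⟨N, hN⟩ := (hs.image fun r => r.toWord.length).bddAbove
    exact ⟨N, fun r hr => hN ⟨r, hr, rfl⟩⟩
  -- The bound N + 1 keeps single letters in the set even when N = 0.
  let X : Set G := (fun w => π (FreeGroup.mk w)) '' {w : List (Fin n × Bool) | w.length ≤ N + 1}
  have hX : X.Finite := (List.finite_length_le _ _).image _
  have : Finite X := hX
  refine ⟨X, trueTriples X, hX, Set.toFinite _, ?_⟩
  have memX (w : List (Fin n × Bool)) (hw : w.length ≤ N + 1) : π (FreeGroup.mk w) ∈ X :=
    ⟨w, hw, rfl⟩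
  have hone : (PresentedGroup.of ⟨_, memX [] (by simp)⟩ :
      PresentedGroup (tripleRelators (trueTriples X))) = 1 := by
    -- The generator named by 1 is idempotent in the presented group, hence trivial.
    have h : π (FreeGroup.mk []) * π (FreeGroup.mk []) = π (FreeGroup.mk []) :=
      (map_mul π _ _).symm
    exact mul_eq_left.1 (of_mul_of_eq_of_trueTriples (a := ⟨_, memX [] (by simp)⟩) h)
  let ψ : FreeGroup (Fin n) →* PresentedGroup (tripleRelators (trueTriples X)) :=
    FreeGroup.lift fun i => PresentedGroup.of ⟨_, memX [(i, true)] (by simp)⟩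
  have hψ_letter (x : Fin n × Bool) :
      ψ (FreeGroup.mk [x]) = PresentedGroup.of ⟨_, memX [x] (by simp)⟩ := by
    have htrue (i : Fin n) :
        ψ (FreeGroup.mk [(i, true)]) = PresentedGroup.of ⟨_, memX [(i, true)] (by simp)⟩ :=
      FreeGroup.lift_apply_of
    obtain ⟨i, _ | _⟩ := x
    · have : (FreeGroup.mk [(i, false)]) = (FreeGroup.mk [(i, true)])⁻¹ := rfl
      refine (congrArg ψ this).trans ?_
      -- The values of a letter, of its inverse and of the empty word all lie in `X`, so their
      -- product relation is available.
      rw [map_inv, htrue, inv_eq_iff_mul_eq_one, ← hone]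
      refine of_mul_of_eq_of_trueTriples ((map_mul π _ _).symm.trans (congrArg π ?_))
      rw [this, mul_inv_cancel]
      rfl
    · exact htrue i
  have hψ (w : List (Fin n × Bool)) (hw : w.length ≤ N + 1) :
      ψ (FreeGroup.mk w) = PresentedGroup.of ⟨_, memX w hw⟩ := by
    induction w with
    | nil => rw [hone]; exact map_one ψ
    | cons x w ih =>
      have hxw : FreeGroup.mk (x :: w) = FreeGroup.mk [x] * FreeGroup.mk w := rfl
      refine (congrArg ψ hxw).trans ?_
      rw [map_mul, hψ_letter, ih ((Nat.le_succ _).trans hw)]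
      exact of_mul_of_eq_of_trueTriples (map_mul π _ _).symm
  let ψ' : PresentedGroup s →* PresentedGroup (tripleRelators (trueTriples X)) :=
    QuotientGroup.lift _ ψ (by
      refine Subgroup.normalClosure_le_normal (N := ψ.ker) fun r hr => ?_
      have h := hψ r.toWord ((hN r hr).trans (Nat.le_succ _))
      refine MonoidHom.mem_ker.2
        ((congrArg ψ FreeGroup.mk_toWord.symm).trans (h.trans (Eq.trans ?_ hone)))
      congr 2
      rw [FreeGroup.mk_toWord, hπ r hr]
      exact (map_one π).symm)
  have hψ' (w : FreeGroup (Fin n)) : ψ' (θ (π w)) = ψ w := by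
    simp only [π, MonoidHom.comp_apply]
    exact congrArg ψ' (θ.apply_symm_apply _)
  have heval (w : FreeGroup (Fin n)) : evalTriples X (ψ w) = π w := by
    suffices (evalTriples X).comp ψ = π from DFunLike.congr_fun this w
    ext i
    simp only [ψ, MonoidHom.comp_apply, FreeGroup.lift_apply_of, evalTriples_of]
    rfl
  have hπ_surj : Function.Surjective π :=
    θ.symm.surjective.comp (PresentedGroup.mk_surjective s)
  refine ⟨MonoidHom.toMulEquiv (evalTriples X) (ψ'.comp θ.toMonoidHom) ?_ ?_⟩
  · refine PresentedGroup.ext fun ⟨a, w, hw, hwa⟩ => ?_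
    subst hwa
    rw [MonoidHom.comp_apply, evalTriples_of]
    exact (hψ' _).trans (hψ w hw)
  · refine MonoidHom.ext fun g => ?_
    obtain ⟨w, rfl⟩ := hπ_surj g
    exact (congrArg _ (hψ' w)).trans (heval w)

end Presentations

theorem theorem1 (G : Type u) [Group G] :
    -- every group is a maximal subgroup of the free idempotent generated semigroup over a band
    (∃ (B : Type u) (_ : Semigroup B), IsBand B ∧
      ∃ H : Subsemigroup (IG B), IsMaximalSubgroup H ∧ Nonempty (H ≃* G)) ∧
    -- for a finitely presented group there is a finite such band
    (Group.IsFinitelyPresented G →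
      ∃ (B : Type u) (_ : Semigroup B), IsBand B ∧ Finite B ∧
        ∃ H : Subsemigroup (IG B), IsMaximalSubgroup H ∧ Nonempty (H ≃* G)) ∧
    -- existence of the (finite) presentations from which the explicit band is built
    (∃ (A : Type u) (R : Set (A × A × A)), IsPresentedBy G A R) ∧
    (Group.IsFinitelyPresented G →
      ∃ (A : Type u) (R : Set (A × A × A)), Finite A ∧ R.Finite ∧ IsPresentedBy G A R) ∧
    -- the explicit band `K ∪ L` for an arbitrary presentation with relations `ab = c`
    (∀ (A : Type v) (R : Set (A × A × A)), IsPresentedBy G A R →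
      IsBand (BandConstruction.B R) ∧
      (∀ x ∈ BandConstruction.K A, ∀ y ∈ BandConstruction.K A, x * y * x = x) ∧
      (∀ x ∈ BandConstruction.L R, ∀ y ∈ BandConstruction.L R, x * y = x) ∧
      (Finite A → Finite (BandConstruction.B R)) ∧
      ∃ H : Subsemigroup (IG (BandConstruction.B R)), IsMaximalSubgroup H ∧
        IG.ι ⟨BandConstruction.e₀ R, BandConstruction.isIdempotentElem_e₀ R⟩ ∈ H ∧
        Nonempty (H ≃* G)) := by
  have hfin (hG : Group.IsFinitelyPresented G) := exists_finite_isPresentedBy G hG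
  refine ⟨?_, fun hG => ?_, ⟨_, _, isPresentedBy_univ G⟩, hfin, fun A R h => ?_⟩
  · obtain ⟨H, hH, -, e⟩ := BandConstruction.exists_maximalSubgroup (isPresentedBy_univ G)
    exact ⟨_, _, BandConstruction.isBand_B _, H, hH, e⟩
  · obtain ⟨A, R, hA, -, h⟩ := hfin hG
    obtain ⟨H, hH, -, e⟩ := BandConstruction.exists_maximalSubgroup h
    exact ⟨_, _, BandConstruction.isBand_B R, BandConstruction.finite_B R, H, hH, e⟩
  · refine ⟨BandConstruction.isBand_B R, fun x hx y hy => ?_, fun x hx y hy => ?_,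
      fun _ => BandConstruction.finite_B R, BandConstruction.exists_maximalSubgroup h⟩
    · obtain ⟨i, j, rfl⟩ := BandConstruction.exists_kElem_of_mem_K hx
      obtain ⟨k, l, rfl⟩ := BandConstruction.exists_kElem_of_mem_K hy
      rfl
    · obtain ⟨p, q, t, rfl⟩ := BandConstruction.exists_lElem_of_mem_L hx
      obtain ⟨p', q', t', rfl⟩ := BandConstruction.exists_lElem_of_mem_L hy
      exact BandConstruction.lElem_mul_lElem ..
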